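/- Let $J$ be a discrete random variable with values in an index set $\mathcal J$ and probabilities $(\pi_j)_{j\in\mathcal J}$, let $\mu_j\in\mathbb R^d$ ($j\in\mathcal J$) be arbitrary vectors, and put $U=\mu_J$. Let $\epsilon\ge 0$, let $G_0\sim\mathcal N(0,I_d)$ be independent of $J$, and let $Z=U+\epsilon G_0$. Assume that $$H(J):=-\sum_{j\in\mathcal J}\pi_j\log\pi_j<\infty\qquad\text{and}\qquad \mathbb E\|Z\|^2=R<\infty .$$ (Here $\log$ is the natural logarithm, $0\log 0=0$, and $\|\cdot\|$ is the Euclidean norm.) For $\eta>0$ let $$\mathrm{mmse}(\eta):=\mathbb E\left[\bigl\|U-\mathbb E[\,U\mid U+\eta^{-1/2}G\,]\bigr\|^2\right],$$ where $G\sim\mathcal N(0,I_d)$ is independent of $U$. Then, for every $\eta>0$, $$\mathrm{mmse}(\eta)\le\min\left\{R,\frac{2H(J)}{\eta}\right\}.$$ -/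

import Mathlib

open MeasureTheory ProbabilityTheory
open scoped ENNReal NNReal

/-- Shannon entropy (in nats) `H = -∑ j, π j * log (π j)` of a discrete distribution, as an element
of `[0, ∞]`; every term `Real.negMulLog p = -p * log p` is nonnegative since `0 ≤ p ≤ 1`. -/
noncomputable def shannonEntropy {ι : Type*} (π : PMF ι) : ℝ≥0∞ :=
  ∑' j, ENNReal.ofReal (Real.negMulLog (π j).toReal)

/-- The Gaussian mixture model: `Z = U + ε G₀` with `U = μ_J`, where `J` is a discrete random
variable with probabilities `π`, `G₀` is a standard Gaussian vector independent of `J`, the entropy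
of `J` is finite and `𝔼 ‖Z‖² = R < ∞`. -/
structure IsGaussianMixtureTarget {Ω : Type*} [MeasurableSpace Ω] (P : Measure Ω)
    {ι : Type*} [MeasurableSpace ι] {d : ℕ} (π : PMF ι) (μ : ι → EuclideanSpace ℝ (Fin d))
    (ε : ℝ) (J : Ω → ι) (G₀ : Ω → EuclideanSpace ℝ (Fin d)) (R : ℝ≥0) : Prop where
  eps_nonneg : 0 ≤ ε
  measurable_latent : Measurable J
  law_latent : P.map J = π.toMeasure
  measurable_noise : Measurable G₀
  law_noise : P.map G₀ = stdGaussian (EuclideanSpace ℝ (Fin d))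
  indep : IndepFun J G₀ P
  entropy_ne_top : shannonEntropy π ≠ ∞
  second_moment : ∫⁻ ω, ‖μ (J ω) + ε • G₀ ω‖ₑ ^ 2 ∂P = R

/-- `𝔼 ‖U - 𝔼[U | U + η^{-1/2} G]‖²`, as an element of `[0, ∞]`. The conditional expectation is the
one given the σ-algebra generated by the observation `U + η^{-1/2} G`. -/
noncomputable def mmse {Ω : Type*} [MeasurableSpace Ω] (P : Measure Ω) {d : ℕ}
    (U G : Ω → EuclideanSpace ℝ (Fin d)) (η : ℝ) : ℝ≥0∞ :=
  ∫⁻ ω, ‖U ω - (P[U | MeasurableSpace.comap (fun ω' => U ω' + η ^ (-(1 / 2) : ℝ) • G ω')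
    inferInstance]) ω‖ₑ ^ 2 ∂P

/-!
The bound `mmse ≤ R` holds because `0` is an estimator and centred independent noise only increases
the second moment (`enorm_sq_le_lintegral_add_smul`). The bound `η * mmse ≤ 2 * H` says that
observing the signal through Gaussian noise gains at least `η * mmse / 2` nats about the label,
while at most `H` nats can be gained.

Consider first finitely many points `x k` with unnormalised weights `q k`. Observing a Gaussian
vector multiplies each weight by a likelihood ratio `lik s (x k) g`, where `g` is standard Gaussian;
this uses the pure noise law as reference, and the Cameron–Martin formula `withDensity_lik` converts
to the true law of the observation. In terms of the posterior weights, `spread` is the posterior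
variance and `massEntropy` the posterior entropy, both homogeneous of degree one. Three facts are
used.

* Expected spread decreases under observation (`lintegral_spread_le`).
* A weak observation, of squared strength `s ^ 2`, lowers the expected entropy by at least
  `s ^ 2 / 2 * spread`, up to `O(s ^ 4)` (`lintegral_massEntropy_add_le`). This is the linearised
  Gibbs variational principle applied to the log-likelihood ratio centred at the prior mean.
* Observations of squared strengths `s ^ 2` and `t ^ 2` compose to one of squared strength
  `s ^ 2 + t ^ 2` (`lintegral_lintegral_spread`).

Cutting an observation of squared strength `η` into `n` equal ones, every step lowers the entropy
by at least `η / (2 * n)` times the final expected spread, up to `O(n⁻²)`, and the entropy stays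
nonnegative. As `n → ∞` this gives `η * spread ≤ 2 * entropy` (`mul_lintegral_spread_le`).

For countably many atoms, the posterior means of the finite sub-mixtures converge pointwise to the
full posterior mean, and Fatou's lemma transfers the bound (`exists_estimator`). Finally, the
conditional expectation beats every estimator (`lintegral_sub_condExp_le`), and the law of
`U = μ_J` has at most the entropy of `J` (`shannonEntropy_map_le`).
-/

/-! ### Exponential tilting of the standard Gaussian measure -/

section Likelihood

variable {E : Type*} [NormedAddCommGroup E] [InnerProductSpace ℝ E]

/-- The likelihood ratio of `𝒩(s² v, s² I)` to `𝒩(0, s² I)`, evaluated at the point `s • g`. -/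
noncomputable def lik (s : ℝ) (v g : E) : ℝ :=
  Real.exp (s * inner ℝ g v - s ^ 2 * ‖v‖ ^ 2 / 2)

theorem lik_pos (s : ℝ) (v g : E) : 0 < lik s v g := Real.exp_pos _

end Likelihood

section GaussianShift

variable {E : Type*} [NormedAddCommGroup E] [InnerProductSpace ℝ E] [FiniteDimensional ℝ E]
  [MeasurableSpace E] [BorelSpace E]

/-- The Fourier–Laplace transform of the standard Gaussian measure. -/
theorem integral_cexp_stdGaussian (v t : E) :
    ∫ g, Complex.exp ((inner ℝ g v : ℝ) + (inner ℝ g t : ℝ) * Complex.I) ∂stdGaussian E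
      = Complex.exp ((‖v‖ ^ 2 / 2 : ℝ) - (‖t‖ ^ 2 / 2 : ℝ) + (inner ℝ v t : ℝ) * Complex.I) := by
  let b := stdOrthonormalBasis ℝ E
  rw [stdGaussian_eq_map_pi_orthonormalBasis b, integral_map (Measurable.aemeasurable (by fun_prop))
    (Measurable.aestronglyMeasurable (by fun_prop))]
  have h1 : ∀ x : Fin (Module.finrank ℝ E) → ℝ,
      Complex.exp ((inner ℝ (∑ i, x i • b i) v : ℝ) + (inner ℝ (∑ i, x i • b i) t : ℝ) * Complex.I)
        = ∏ i, Complex.exp (((inner ℝ (b i) v : ℝ) + (inner ℝ (b i) t : ℝ) * Complex.I) *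
          (x i : ℂ)) := by
    intro x
    rw [← Complex.exp_sum, sum_inner, sum_inner]
    congr 1
    push_cast
    rw [Finset.sum_mul, ← Finset.sum_add_distrib]
    refine Finset.sum_congr rfl fun i _ => ?_
    rw [real_inner_smul_left, real_inner_smul_left]
    push_cast
    ring
  simp_rw [h1]
  rw [integral_fintype_prod_eq_prod (f := fun i (x : ℝ) =>
    Complex.exp (((inner ℝ (b i) v : ℝ) + (inner ℝ (b i) t : ℝ) * Complex.I) * (x : ℂ)))]
  have h2 : ∀ z : ℂ, ∫ x : ℝ, Complex.exp (z * x) ∂gaussianReal 0 1 = Complex.exp (z ^ 2 / 2) := by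
    intro z
    have := complexMGF_id_gaussianReal (μ := 0) (v := 1) z
    simpa [complexMGF] using this
  simp_rw [h2]
  rw [← Complex.exp_sum]
  congr 1
  rw [← b.sum_sq_inner_right v, ← b.sum_sq_inner_right t, ← b.sum_inner_mul_inner v t]
  push_cast
  rw [Finset.sum_mul, Finset.sum_div, Finset.sum_div, ← Finset.sum_sub_distrib,
    ← Finset.sum_add_distrib]
  refine Finset.sum_congr rfl fun i _ => ?_
  rw [real_inner_comm (b i) v]
  linear_combination (1 / 2 * ((inner ℝ (b i) t : ℝ) : ℂ) ^ 2) * Complex.I_sq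

@[fun_prop]
theorem measurable_lik (s : ℝ) (v : E) : Measurable (lik s v) := by
  unfold lik; fun_prop

theorem integrable_lik (s : ℝ) (v : E) : Integrable (lik s v) (stdGaussian E) := by
  have h := integral_cexp_stdGaussian (s • v) 0
  -- The integral below is nonzero, so the integrand is integrable: otherwise it would be `0`.
  have h2 : Integrable (fun g : E => Complex.exp ((inner ℝ g (s • v) : ℝ) +
      (inner ℝ g 0 : ℝ) * Complex.I)) (stdGaussian E) := by
    by_contra hc
    rw [integral_undef hc] at h
    exact Complex.exp_ne_zero _ h.symm
  have h3 := h2.norm.mul_const (Real.exp (-(s ^ 2 * ‖v‖ ^ 2 / 2)))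
  refine h3.congr (Filter.Eventually.of_forall fun g => ?_)
  simp only [Complex.norm_exp, lik]
  rw [← Real.exp_add]
  congr 1
  simp [real_inner_smul_right]
  ring

/-- The Cameron–Martin formula: tilting the standard Gaussian measure by the likelihood ratio
translates it. -/
theorem withDensity_lik (s : ℝ) (v : E) :
    (stdGaussian E).withDensity (fun g => ENNReal.ofReal (lik s v g))
      = (stdGaussian E).map (fun g => g + s • v) := by
  have : IsFiniteMeasure ((stdGaussian E).withDensity (fun g => ENNReal.ofReal (lik s v g))) :=
    isFiniteMeasure_withDensity_ofReal (integrable_lik s v).2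
  have : IsProbabilityMeasure ((stdGaussian E).map (fun g => g + s • v)) :=
    Measure.isProbabilityMeasure_map (by fun_prop)
  refine Measure.ext_of_charFun (funext fun t => ?_)
  have hr : charFun ((stdGaussian E).map (fun g => g + s • v)) t
      = charFun (stdGaussian E) t * Complex.exp ((inner ℝ (s • v) t : ℝ) * Complex.I) := by
    rw [charFun_apply, integral_map (by fun_prop) (by fun_prop), charFun_apply,
      ← integral_mul_const]
    refine integral_congr_ae (Filter.Eventually.of_forall fun g => ?_)
    simp only
    rw [← Complex.exp_add, inner_add_left]
    push_cast
    ring_nf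
  rw [hr, charFun_stdGaussian, charFun_apply,
    integral_withDensity_eq_integral_toReal_smul (by fun_prop) (by simp)]
  have h := integral_cexp_stdGaussian (s • v) t
  have e : ∀ g : E, (ENNReal.ofReal (lik s v g)).toReal • Complex.exp ((inner ℝ g t : ℝ) * Complex.I)
      = Complex.exp ((inner ℝ g (s • v) : ℝ) + (inner ℝ g t : ℝ) * Complex.I) *
        Complex.exp (-(‖s • v‖ ^ 2 / 2 : ℝ)) := by
    intro g
    rw [ENNReal.toReal_ofReal (lik_pos _ _ _).le, lik, Complex.real_smul, Complex.ofReal_exp,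
      ← Complex.exp_add, ← Complex.exp_add, norm_smul, mul_pow, Real.norm_eq_abs, sq_abs,
      real_inner_smul_right]
    push_cast
    ring_nf
  simp_rw [e]
  rw [integral_mul_const, h, ← Complex.exp_add, ← Complex.exp_add]
  push_cast
  ring_nf

theorem lintegral_lik_mul (s : ℝ) (v : E) {f : E → ℝ≥0∞} (hf : Measurable f) :
    ∫⁻ g, ENNReal.ofReal (lik s v g) * f g ∂stdGaussian E
      = ∫⁻ g, f (g + s • v) ∂stdGaussian E := by
  rw [← lintegral_map hf (by fun_prop), ← withDensity_lik,
    lintegral_withDensity_eq_lintegral_mul _ (by fun_prop) hf]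
  rfl

theorem integral_lik_mul (s : ℝ) (v : E) {f : E → ℝ} (hf : Measurable f) :
    ∫ g, lik s v g * f g ∂stdGaussian E = ∫ g, f (g + s • v) ∂stdGaussian E := by
  rw [← integral_map (f := f) (by fun_prop) hf.aestronglyMeasurable, ← withDensity_lik,
    integral_withDensity_eq_integral_toReal_smul (by fun_prop) (by simp)]
  refine integral_congr_ae (Filter.Eventually.of_forall fun g => ?_)
  simp [ENNReal.toReal_ofReal (lik_pos _ _ _).le]

theorem integrable_lik_mul_iff (s : ℝ) (v : E) {f : E → ℝ} (hf : Measurable f) :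
    Integrable (fun g => lik s v g * f g) (stdGaussian E)
      ↔ Integrable (fun g => f (g + s • v)) (stdGaussian E) := by
  have h := integrable_map_measure (μ := stdGaussian E) (f := fun g : E => g + s • v) (g := f)
    hf.aestronglyMeasurable (by fun_prop)
  rw [← withDensity_lik, integrable_withDensity_iff (by fun_prop) (by simp)] at h
  rw [show (fun g => f (g + s • v)) = f ∘ (fun g => g + s • v) from rfl, ← h]
  refine integrable_congr (Filter.Eventually.of_forall fun g => ?_)
  simp [ENNReal.toReal_ofReal (lik_pos _ _ _).le, mul_comm]

theorem integral_lik (s : ℝ) (v : E) : ∫ g, lik s v g ∂stdGaussian E = 1 := by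
  simpa using integral_lik_mul s v (f := fun _ => (1 : ℝ)) measurable_const

/-- Independent centred Gaussian increments add up: the variances `s²` and `t²` sum to `u²`. -/
theorem lintegral_lintegral_stdGaussian {s t u : ℝ} (h : s ^ 2 + t ^ 2 = u ^ 2) {f : E → ℝ≥0∞}
    (hf : Measurable f) :
    ∫⁻ g, ∫⁻ g', f (s • g + t • g') ∂stdGaussian E ∂stdGaussian E
      = ∫⁻ g, f (u • g) ∂stdGaussian E := by
  have key : ((stdGaussian E).map (s • ·)) ∗ ((stdGaussian E).map (t • ·))
      = (stdGaussian E).map (u • ·) := by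
    have i1 (s : ℝ) : IsProbabilityMeasure ((stdGaussian E).map (s • ·)) :=
      Measure.isProbabilityMeasure_map (by fun_prop)
    refine Measure.ext_of_charFun (funext fun z => ?_)
    rw [charFun_conv, charFun_map_smul, charFun_map_smul, charFun_map_smul, charFun_stdGaussian,
      charFun_stdGaussian, charFun_stdGaussian, ← Complex.exp_add]
    congr 1
    simp only [norm_smul, Real.norm_eq_abs]
    norm_cast
    rw [mul_pow, mul_pow, mul_pow, sq_abs, sq_abs, sq_abs, ← h]
    ring
  rw [← lintegral_map hf (by fun_prop), ← key, Measure.lintegral_conv hf,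
    lintegral_map (Measurable.lintegral_prod_right (by fun_prop)) (by fun_prop)]
  refine lintegral_congr fun g => ?_
  rw [lintegral_map (by fun_prop) (by fun_prop)]

end GaussianShift

/-! ### Entropy loss of a finite mixture under Gaussian observation -/

section FiniteMixture

variable {κ E : Type*} [NormedAddCommGroup E] [InnerProductSpace ℝ E]

/-- The barycentre of the points `x k`, `k ∈ F`, with unnormalised weights `q k`. -/
noncomputable def bary (F : Finset κ) (x : κ → E) (q : κ → ℝ) : E :=
  (∑ k ∈ F, q k)⁻¹ • ∑ k ∈ F, q k • x k

/-- The second moment of the weights `q` on the points `x k`, `k ∈ F`, about their barycentre.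
It is homogeneous of degree one in `q`: the total mass times the variance of the normalised
weights. -/
noncomputable def spread (F : Finset κ) (x : κ → E) (q : κ → ℝ) : ℝ :=
  ∑ k ∈ F, q k * ‖x k - bary F x q‖ ^ 2

/-- The total mass of the weights `q` on `F` times the Shannon entropy of the normalised weights. -/
noncomputable def massEntropy (F : Finset κ) (q : κ → ℝ) : ℝ :=
  ∑ k ∈ F, q k * Real.log ((∑ k ∈ F, q k) / q k)

variable {F : Finset κ} {x : κ → E} {q : κ → ℝ}

theorem sum_smul_sub_bary (hF : F.Nonempty) (hq : ∀ k ∈ F, 0 < q k) :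
    ∑ k ∈ F, q k • (x k - bary F x q) = 0 := by
  have hQ : (∑ k ∈ F, q k) ≠ 0 := (Finset.sum_pos hq hF).ne'
  simp only [smul_sub, Finset.sum_sub_distrib, ← Finset.sum_smul, bary]
  rw [smul_smul, mul_inv_cancel₀ hQ, one_smul, sub_self]

/-- The barycentre minimises the weighted second moment. -/
theorem spread_le (hF : F.Nonempty) (hq : ∀ k ∈ F, 0 < q k) (a : E) :
    spread F x q ≤ ∑ k ∈ F, q k * ‖x k - a‖ ^ 2 := by
  set m := bary F x q with hm
  have h0 : ∑ k ∈ F, q k * inner ℝ (x k - m) (m - a) = 0 := by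
    have := congrArg (fun z => inner ℝ z (m - a)) (sum_smul_sub_bary (x := x) hF hq)
    simpa [sum_inner, real_inner_smul_left] using this
  have h1 : ∀ k ∈ F, q k * ‖x k - a‖ ^ 2 = q k * ‖x k - m‖ ^ 2
      + 2 * (q k * inner ℝ (x k - m) (m - a)) + q k * ‖m - a‖ ^ 2 := by
    intro k _
    rw [← sub_add_sub_cancel (x k) m a, norm_add_sq_real]
    ring
  rw [Finset.sum_congr rfl h1, Finset.sum_add_distrib, Finset.sum_add_distrib, ← Finset.mul_sum, h0]
  have : 0 ≤ ∑ k ∈ F, q k * ‖m - a‖ ^ 2 :=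
    Finset.sum_nonneg fun k hk => mul_nonneg (hq k hk).le (sq_nonneg _)
  simp only [spread, ← hm]
  linarith

theorem spread_nonneg (hq : ∀ k ∈ F, 0 < q k) : 0 ≤ spread F x q :=
  Finset.sum_nonneg fun k hk => mul_nonneg (hq k hk).le (sq_nonneg _)

theorem massEntropy_nonneg (hq : ∀ k ∈ F, 0 < q k) : 0 ≤ massEntropy F q :=
  Finset.sum_nonneg fun k hk => mul_nonneg (hq k hk).le <| Real.log_nonneg <|
    (one_le_div (hq k hk)).2 <| Finset.single_le_sum (fun i hi => (hq i hi).le) hk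

theorem norm_bary_le (hF : F.Nonempty) (hq : ∀ k ∈ F, 0 < q k) {B : ℝ} (hB : ∀ k ∈ F, ‖x k‖ ≤ B) :
    ‖bary F x q‖ ≤ B := by
  have hQ : 0 < ∑ k ∈ F, q k := Finset.sum_pos hq hF
  rw [bary, norm_smul, norm_inv, Real.norm_of_nonneg hQ.le, inv_mul_le_iff₀ hQ, Finset.sum_mul]
  refine (norm_sum_le _ _).trans (Finset.sum_le_sum fun k hk => ?_)
  rw [norm_smul, Real.norm_of_nonneg (hq k hk).le]
  exact mul_le_mul_of_nonneg_left (hB k hk) (hq k hk).le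

theorem measurable_bary [MeasurableSpace E] [BorelSpace E] [SecondCountableTopology E] :
    Measurable (bary F x) := by
  unfold bary
  fun_prop

theorem measurable_spread [MeasurableSpace E] [BorelSpace E] [SecondCountableTopology E] :
    Measurable (spread F x) := by
  have := measurable_bary (F := F) (x := x)
  unfold spread
  fun_prop

/-- A linearised form of the Gibbs variational principle, `log z ≤ z - 1`. -/
theorem mul_log_div_le {a A q Q f : ℝ} (ha : 0 < a) (hA : 0 < A) (hq : 0 < q) (hQ : 0 < Q) :
    a * Real.log (A / a) ≤ a * (Real.log (Q / q) - 1 - f) + q / Q * (A * Real.exp f) := by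
  have h := Real.log_le_sub_one_of_pos (x := A / a * (q / Q) * Real.exp f) (by positivity)
  rw [Real.log_mul (by positivity) (by positivity), Real.log_mul (by positivity) (by positivity),
    Real.log_exp, ← inv_div Q q, Real.log_inv] at h
  have h2 := mul_le_mul_of_nonneg_left h ha.le
  have h3 : a * (A / a * (Q / q)⁻¹ * Real.exp f - 1) = q / Q * (A * Real.exp f) - a := by
    field_simp
  linarith

/-- The exponential moment of the inner product of two independent centred points: the first-order
term vanishes by centring, so only a term of order `τ ^ 2` exceeds the total mass. -/
theorem sum_sum_exp_inner_le (hF : F.Nonempty) (hq : ∀ k ∈ F, 0 < q k) {K τ : ℝ} (hτ : 0 ≤ τ)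
    (hK : ∀ k ∈ F, ‖x k - bary F x q‖ ≤ K) (hτK : τ * K ^ 2 ≤ 1) :
    ∑ j ∈ F, ∑ k ∈ F, q j / (∑ i ∈ F, q i) *
        (q k * Real.exp (τ * inner ℝ (x k - bary F x q) (x j - bary F x q)))
      ≤ (∑ k ∈ F, q k) + τ ^ 2 * K ^ 2 * spread F x q := by
  set m := bary F x q with hm
  set Q := ∑ i ∈ F, q i with hQd
  have hQ : 0 < Q := Finset.sum_pos hq hF
  have h0 : ∀ j, ∑ k ∈ F, q k * inner ℝ (x k - m) (x j - m) = 0 := fun j => by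
    have := congrArg (fun z => inner ℝ z (x j - m)) (sum_smul_sub_bary (x := x) hF hq)
    simpa [sum_inner, real_inner_smul_left] using this
  have hb : ∀ j ∈ F, ∑ k ∈ F, q j / Q * (q k * Real.exp (τ * inner ℝ (x k - m) (x j - m)))
      ≤ q j + τ ^ 2 * K ^ 2 * (q j * ‖x j - m‖ ^ 2) := by
    intro j hj
    have hqj := hq j hj
    calc ∑ k ∈ F, q j / Q * (q k * Real.exp (τ * inner ℝ (x k - m) (x j - m)))
        ≤ ∑ k ∈ F, (q j / Q * q k + q j / Q * τ * (q k * inner ℝ (x k - m) (x j - m))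
            + q j / Q * (τ ^ 2 * (K ^ 2 * ‖x j - m‖ ^ 2)) * q k) := by
          refine Finset.sum_le_sum fun k hk => ?_
          have hqk := hq k hk
          have hin := abs_real_inner_le_norm (x k - m) (x j - m)
          have hle : |inner ℝ (x k - m) (x j - m)| ≤ K * ‖x j - m‖ :=
            hin.trans (mul_le_mul_of_nonneg_right (hK k hk) (norm_nonneg _))
          have hK0 : 0 ≤ K := (norm_nonneg _).trans (hK k hk)
          have habs : |τ * inner ℝ (x k - m) (x j - m)| ≤ 1 := by
            rw [abs_mul, abs_of_nonneg hτ]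
            refine (mul_le_mul_of_nonneg_left (hle.trans
              (mul_le_mul_of_nonneg_left (hK j hj) hK0)) hτ).trans ?_
            rwa [← sq]
          have hexp := (abs_le.1 (Real.abs_exp_sub_one_sub_id_le habs)).2
          have hsq : (τ * inner ℝ (x k - m) (x j - m)) ^ 2 ≤ τ ^ 2 * (K ^ 2 * ‖x j - m‖ ^ 2) := by
            rw [mul_pow, ← mul_pow K]
            exact mul_le_mul_of_nonneg_left (sq_le_sq.2 (hle.trans (le_abs_self _))) (sq_nonneg _)
          have := mul_le_mul_of_nonneg_left (show Real.exp (τ * inner ℝ (x k - m) (x j - m))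
            ≤ 1 + τ * inner ℝ (x k - m) (x j - m) + τ ^ 2 * (K ^ 2 * ‖x j - m‖ ^ 2) by linarith)
            (show 0 ≤ q j / Q * q k by positivity)
          linarith
      _ = q j + τ ^ 2 * K ^ 2 * (q j * ‖x j - m‖ ^ 2) := by
          rw [Finset.sum_add_distrib, Finset.sum_add_distrib, ← Finset.mul_sum, ← Finset.mul_sum,
            ← Finset.mul_sum, h0, ← hQd]
          field_simp
          ring
  refine (Finset.sum_le_sum hb).trans_eq ?_
  rw [Finset.sum_add_distrib, ← Finset.mul_sum]
  rfl

variable [FiniteDimensional ℝ E] [MeasurableSpace E] [BorelSpace E]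

theorem integral_sum_mul_lik_mul_const (s : ℝ) (c : κ → ℝ) :
    ∫ g, ∑ k ∈ F, q k * lik s (x k) g * c k ∂stdGaussian E = ∑ k ∈ F, q k * c k := by
  rw [integral_finsetSum _ fun k _ => ((integrable_lik s (x k)).const_mul (q k)).mul_const _]
  simp_rw [integral_mul_const, integral_const_mul, integral_lik, mul_one]

/-- Expected posterior spread does not exceed the prior spread. -/
theorem lintegral_spread_le (hF : F.Nonempty) (hq : ∀ k ∈ F, 0 < q k) (s : ℝ) :
    ∫⁻ g, ENNReal.ofReal (spread F x (fun k => q k * lik s (x k) g)) ∂stdGaussian E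
      ≤ ENNReal.ofReal (spread F x q) := by
  calc ∫⁻ g, ENNReal.ofReal (spread F x (fun k => q k * lik s (x k) g)) ∂stdGaussian E
      ≤ ∫⁻ g, ENNReal.ofReal (∑ k ∈ F, q k * lik s (x k) g * ‖x k - bary F x q‖ ^ 2)
          ∂stdGaussian E :=
        lintegral_mono fun g => ENNReal.ofReal_le_ofReal <|
          spread_le hF (fun k hk => mul_pos (hq k hk) (lik_pos _ _ _)) _
    _ = ENNReal.ofReal (spread F x q) := by
        rw [← ofReal_integral_eq_lintegral_ofReal, integral_sum_mul_lik_mul_const]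
        · rfl
        · exact integrable_finsetSum _ fun k _ =>
            ((integrable_lik s (x k)).const_mul (q k)).mul_const _
        · exact Filter.Eventually.of_forall fun g => Finset.sum_nonneg fun k hk =>
            mul_nonneg (mul_pos (hq k hk) (lik_pos _ _ _)).le (sq_nonneg _)

/-- One observation of squared signal strength `s ^ 2` lowers the expected entropy by at least
`s ^ 2 / 2` times the prior spread, up to an error of order `s ^ 4`. -/
theorem lintegral_massEntropy_add_le (hF : F.Nonempty) (hq : ∀ k ∈ F, 0 < q k) {s K : ℝ}
    (hK : ∀ k ∈ F, ‖x k - bary F x q‖ ≤ K) (hsK : s ^ 2 * K ^ 2 ≤ 1)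
    (hc : 0 ≤ s ^ 2 / 2 - s ^ 4 * K ^ 2) :
    ∫⁻ g, ENNReal.ofReal (massEntropy F (fun k => q k * lik s (x k) g)) ∂stdGaussian E
        + ENNReal.ofReal ((s ^ 2 / 2 - s ^ 4 * K ^ 2) * spread F x q)
      ≤ ENNReal.ofReal (massEntropy F q) := by
  set m := bary F x q with hm
  set Q := ∑ i ∈ F, q i with hQd
  have hQ : 0 < Q := Finset.sum_pos hq hF
  -- The log-likelihood ratio of the law given `j` to the Gaussian law centred at the prior mean;
  -- it is the first-order approximation of the true log-likelihood ratio `log (posterior / prior)`.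
  let f : κ → E → ℝ := fun j g =>
    s * inner ℝ g (x j - m) - s ^ 2 * inner ℝ m (x j - m) - s ^ 2 * ‖x j - m‖ ^ 2 / 2
  have hf1 : ∀ j g, f j (g + s • x j) = s * inner ℝ g (x j - m) + s ^ 2 * ‖x j - m‖ ^ 2 / 2 := by
    intro j g
    have : inner ℝ (x j) (x j - m) = inner ℝ m (x j - m) + ‖x j - m‖ ^ 2 := by
      rw [← real_inner_self_eq_norm_sq, ← inner_add_left, add_sub_cancel]
    simp only [f, inner_add_left, real_inner_smul_left, this]
    ring
  have hf2 : ∀ j k g, Real.exp (f j (g + s • x k))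
      = Real.exp (s ^ 2 * inner ℝ (x k - m) (x j - m)) * lik s (x j - m) g := by
    intro j k g
    rw [lik, ← Real.exp_add]
    simp only [f, inner_add_left, real_inner_smul_left, inner_sub_left]
    ring_nf
  have hlin : ∀ a : E, Integrable (fun g => inner ℝ g a) (stdGaussian E) := fun a => by
    simpa [real_inner_comm] using IsGaussian.integrable_dual (stdGaussian E) (innerSL ℝ a)
  have hlin0 : ∀ a : E, ∫ g, inner ℝ g a ∂stdGaussian E = 0 := fun a => by
    simpa [real_inner_comm] using integral_strongDual_stdGaussian (innerSL ℝ a)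
  let T1 : κ → E → ℝ := fun j g => q j * (lik s (x j) g * (Real.log (Q / q j) - 1 - f j g))
  let T2 : κ → κ → E → ℝ := fun j k g => q j / Q * (q k * (lik s (x k) g * Real.exp (f j g)))
  have hT1i : ∀ j, Integrable (T1 j) (stdGaussian E) := fun j => by
    refine Integrable.const_mul ((integrable_lik_mul_iff s (x j)
      (f := fun g => Real.log (Q / q j) - 1 - f j g) (by fun_prop)).2 ?_) _
    simp only [hf1]
    exact (integrable_const _).sub (((hlin _).const_mul _).add (integrable_const _))
  have hT2i : ∀ j k, Integrable (T2 j k) (stdGaussian E) := fun j k => by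
    refine (((integrable_lik_mul_iff s (x k)
      (f := fun g => Real.exp (f j g)) (by fun_prop)).2 ?_).const_mul _).const_mul _
    simp only [hf2]
    exact (integrable_lik _ _).const_mul _
  have hT1 : ∀ j, ∫ g, T1 j g ∂stdGaussian E
      = q j * Real.log (Q / q j) - q j - s ^ 2 / 2 * (q j * ‖x j - m‖ ^ 2) := fun j => by
    simp only [T1]
    rw [integral_const_mul, integral_lik_mul s (x j)
      (f := fun g => Real.log (Q / q j) - 1 - f j g) (by fun_prop)]
    simp only [hf1]
    rw [integral_sub (integrable_const _)
        (by exact ((hlin _).const_mul _).add (integrable_const _)),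
      integral_add ((hlin _).const_mul _) (integrable_const _), integral_const_mul, hlin0]
    simp
    ring
  have hT2 : ∀ j k, ∫ g, T2 j k g ∂stdGaussian E
      = q j / Q * (q k * Real.exp (s ^ 2 * inner ℝ (x k - m) (x j - m))) := fun j k => by
    simp only [T2]
    rw [integral_const_mul, integral_const_mul, integral_lik_mul s (x k)
      (f := fun g => Real.exp (f j g)) (by fun_prop)]
    simp only [hf2]
    rw [integral_const_mul, integral_lik, mul_one]
  let B : E → ℝ := fun g => ∑ j ∈ F, T1 j g + ∑ j ∈ F, ∑ k ∈ F, T2 j k g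
  have hBi1 : Integrable (fun g => ∑ j ∈ F, T1 j g) (stdGaussian E) :=
    integrable_finsetSum _ fun j _ => hT1i j
  have hBi2 : Integrable (fun g => ∑ j ∈ F, ∑ k ∈ F, T2 j k g) (stdGaussian E) :=
    integrable_finsetSum _ fun j _ => integrable_finsetSum _ fun k _ => hT2i j k
  have hB : ∀ g, massEntropy F (fun k => q k * lik s (x k) g) ≤ B g := by
    intro g
    simp only [B, massEntropy, ← Finset.sum_add_distrib]
    refine Finset.sum_le_sum fun j hj => ?_
    have hA : 0 < ∑ k ∈ F, q k * lik s (x k) g :=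
      Finset.sum_pos (fun k hk => mul_pos (hq k hk) (lik_pos _ _ _)) hF
    refine (mul_log_div_le (f := f j g) (mul_pos (hq j hj) (lik_pos _ _ _)) hA (hq j hj)
      hQ).trans_eq ?_
    simp only [T1, T2]
    rw [Finset.sum_mul, Finset.mul_sum]
    simp only [mul_assoc]
  have hBint : ∫ g, B g ∂stdGaussian E
      ≤ massEntropy F q - (s ^ 2 / 2 - s ^ 4 * K ^ 2) * spread F x q := by
    have h := sum_sum_exp_inner_le hF hq (sq_nonneg s) hK hsK
    simp only [B]
    rw [integral_add hBi1 hBi2, integral_finsetSum _ fun j _ => hT1i j,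
      integral_finsetSum _ fun j _ => integrable_finsetSum _ fun k _ => hT2i j k]
    simp_rw [integral_finsetSum F fun k _ => hT2i _ k, hT1, hT2]
    rw [Finset.sum_sub_distrib, Finset.sum_sub_distrib, ← Finset.mul_sum]
    have e1 : ∑ j ∈ F, q j * Real.log (Q / q j) = massEntropy F q := rfl
    have e2 : ∑ j ∈ F, q j * ‖x j - m‖ ^ 2 = spread F x q := rfl
    rw [e1, e2]
    rw [← hm, ← hQd] at h
    nlinarith [h]
  have hB0 : ∀ g, 0 ≤ B g := fun g =>
    (massEntropy_nonneg fun k hk => mul_pos (hq k hk) (lik_pos _ _ _)).trans (hB g)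
  have hBi : Integrable B (stdGaussian E) := hBi1.add hBi2
  have hle : ∫⁻ g, ENNReal.ofReal (massEntropy F (fun k => q k * lik s (x k) g)) ∂stdGaussian E
      ≤ ENNReal.ofReal (∫ g, B g ∂stdGaussian E) := by
    rw [ofReal_integral_eq_lintegral_ofReal hBi (Filter.Eventually.of_forall hB0)]
    exact lintegral_mono fun g => ENNReal.ofReal_le_ofReal (hB g)
  refine (add_le_add_left hle _).trans ?_
  rw [← ENNReal.ofReal_add (integral_nonneg hB0) (mul_nonneg hc (spread_nonneg hq))]
  exact ENNReal.ofReal_le_ofReal (by linarith)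

/-- Two successive observations of squared strengths `s ^ 2` and `t ^ 2` amount to a single one of
squared strength `u ^ 2 = s ^ 2 + t ^ 2`. -/
theorem lintegral_lintegral_spread {s t u : ℝ} (h : s ^ 2 + t ^ 2 = u ^ 2) :
    ∫⁻ g, ∫⁻ g', ENNReal.ofReal (spread F x (fun k => q k * lik s (x k) g * lik t (x k) g'))
        ∂stdGaussian E ∂stdGaussian E
      = ∫⁻ g, ENNReal.ofReal (spread F x (fun k => q k * lik u (x k) g)) ∂stdGaussian E := by
  have hm : Measurable (fun y : E => ENNReal.ofReal (spread F x
      (fun k => q k * Real.exp (inner ℝ y (x k) - u ^ 2 * ‖x k‖ ^ 2 / 2)))) :=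
    (measurable_spread.comp (by fun_prop)).ennreal_ofReal
  have key := lintegral_lintegral_stdGaussian h hm
  refine Eq.trans (lintegral_congr fun g => lintegral_congr fun g' => ?_)
    (key.trans (lintegral_congr fun g => ?_))
  · refine congrArg ENNReal.ofReal (congrArg (spread F x) (funext fun k => ?_))
    rw [mul_assoc, lik, lik, ← Real.exp_add, inner_add_left, real_inner_smul_left,
      real_inner_smul_left, ← h]
    ring_nf
  · refine congrArg ENNReal.ofReal (congrArg (spread F x) (funext fun k => ?_))
    rw [lik, real_inner_smul_left]

/-- The entropy budget for `n` successive observations of squared strength `r ^ 2`: each of them costs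
at least `r ^ 2 / 2 - r ^ 4 * K ^ 2` times the final expected spread. -/
theorem mul_lintegral_spread_le_of_step (hF : F.Nonempty) {K r : ℝ}
    (hK : ∀ q : κ → ℝ, (∀ k ∈ F, 0 < q k) → ∀ k ∈ F, ‖x k - bary F x q‖ ≤ K)
    (hrK : r ^ 2 * K ^ 2 ≤ 1) (hc : 0 ≤ r ^ 2 / 2 - r ^ 4 * K ^ 2) (n : ℕ) :
    ∀ q : κ → ℝ, (∀ k ∈ F, 0 < q k) →
      ENNReal.ofReal (n * (r ^ 2 / 2 - r ^ 4 * K ^ 2)) *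
        ∫⁻ g, ENNReal.ofReal (spread F x (fun k => q k * lik (√n * r) (x k) g)) ∂stdGaussian E
      ≤ ENNReal.ofReal (massEntropy F q) := by
  set c := r ^ 2 / 2 - r ^ 4 * K ^ 2
  induction n with
  | zero => intro q _; simp
  | succ n ih =>
    intro q hq
    have hsq : r ^ 2 + (√n * r) ^ 2 = (√(n + 1 : ℕ) * r) ^ 2 := by
      rw [mul_pow, mul_pow, Real.sq_sqrt (by positivity), Real.sq_sqrt (by positivity)]
      push_cast; ring
    have hdecr := lintegral_spread_le (x := x) hF hq (√(n + 1 : ℕ) * r)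
    rw [show ((n + 1 : ℕ) : ℝ) * c = n * c + c by push_cast; ring,
      ENNReal.ofReal_add (by positivity) hc, add_mul]
    calc _ ≤ ∫⁻ g, ENNReal.ofReal (massEntropy F (fun k => q k * lik r (x k) g)) ∂stdGaussian E
            + ENNReal.ofReal (c * spread F x q) := by
          refine add_le_add ?_ ?_
          · rw [← lintegral_lintegral_spread hsq, ← lintegral_const_mul' _ _ ENNReal.ofReal_ne_top]
            exact lintegral_mono fun g => ih _ fun k hk => mul_pos (hq k hk) (lik_pos _ _ _)
          · rw [ENNReal.ofReal_mul hc]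
            gcongr
      _ ≤ _ := lintegral_massEntropy_add_le hF hq (hK q hq) hrK hc

/-- For a finite mixture, the expected posterior spread at signal-to-noise ratio `η` is at most
`2 / η` times the entropy. -/
theorem mul_lintegral_spread_le (hF : F.Nonempty) (hq : ∀ k ∈ F, 0 < q k) {η : ℝ} (hη : 0 < η) :
    ENNReal.ofReal η *
        ∫⁻ g, ENNReal.ofReal (spread F x (fun k => q k * lik √η (x k) g)) ∂stdGaussian E
      ≤ 2 * ENNReal.ofReal (massEntropy F q) := by
  set A := ∫⁻ g, ENNReal.ofReal (spread F x (fun k => q k * lik √η (x k) g)) ∂stdGaussian E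
  obtain ⟨B, hB⟩ : ∃ B, ∀ k ∈ F, ‖x k‖ ≤ B :=
    ⟨∑ k ∈ F, ‖x k‖, fun k hk =>
      Finset.single_le_sum (f := fun k => ‖x k‖) (fun i _ => norm_nonneg _) hk⟩
  set K := B + B
  have hK : ∀ q : κ → ℝ, (∀ k ∈ F, 0 < q k) → ∀ k ∈ F, ‖x k - bary F x q‖ ≤ K :=
    fun q hq k hk => (norm_sub_le _ _).trans (add_le_add (hB k hk) (norm_bary_le hF hq hB))
  have hlim : Filter.Tendsto (fun n : ℕ => ENNReal.ofReal (η / 2 - η ^ 2 * K ^ 2 / n) * A)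
      Filter.atTop (nhds (ENNReal.ofReal (η / 2) * A)) := by
    refine ENNReal.Tendsto.mul_const (ENNReal.tendsto_ofReal ?_) (Or.inl (by simpa using hη))
    simpa using (tendsto_const_div_atTop_nhds_zero_nat (η ^ 2 * K ^ 2)).const_sub (η / 2)
  have hle : ENNReal.ofReal (η / 2) * A ≤ ENNReal.ofReal (massEntropy F q) := by
    refine le_of_tendsto hlim ?_
    filter_upwards [Filter.eventually_ge_atTop 1, Filter.eventually_ge_atTop ⌈2 * (η * K ^ 2)⌉₊]
      with n hn1 hn2
    have hn : (0 : ℝ) < n := by exact_mod_cast hn1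
    have hn3 : 2 * (η * K ^ 2) ≤ n := Nat.ceil_le.1 hn2
    have hr2 : √(η / n) ^ 2 = η / n := Real.sq_sqrt (by positivity)
    have hr4 : √(η / n) ^ 4 = (η / n) ^ 2 := by
      rw [show √(η / n) ^ 4 = (√(η / n) ^ 2) ^ 2 by ring, hr2]
    have hηn : η / n * K ^ 2 ≤ 1 / 2 := by
      rw [div_mul_eq_mul_div, div_le_iff₀ hn]; linarith
    have h := mul_lintegral_spread_le_of_step (x := x) hF (r := √(η / n)) hK
      (by rw [hr2]; linarith) (by
        rw [hr2, hr4]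
        have := mul_le_mul_of_nonneg_left hηn (show 0 ≤ η / n by positivity)
        linarith [this]) n q hq
    have e1 : √(n : ℝ) * √(η / n) = √η := by
      rw [← Real.sqrt_mul hn.le, mul_div_cancel₀ _ hn.ne']
    have e2 : (n : ℝ) * (√(η / n) ^ 2 / 2 - √(η / n) ^ 4 * K ^ 2)
        = η / 2 - η ^ 2 * K ^ 2 / n := by
      rw [hr2, hr4]; field_simp
    rwa [e1, e2] at h
  calc ENNReal.ofReal η * A = 2 * (ENNReal.ofReal (η / 2) * A) := by
        rw [← mul_assoc, show (2 : ℝ≥0∞) = ENNReal.ofReal 2 by simp,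
          ← ENNReal.ofReal_mul (by norm_num), mul_div_cancel₀ _ (by norm_num)]
    _ ≤ _ := by gcongr

end FiniteMixture

/-! ### Countable mixtures -/

section CountableMixture

variable {κ E : Type*} [NormedAddCommGroup E] [InnerProductSpace ℝ E] [FiniteDimensional ℝ E]
  [MeasurableSpace E] [BorelSpace E] {x : κ → E} {w : κ → ℝ} {η : ℝ}

/-- The posterior weight, up to normalisation, of the point `x k` given the observation
`y = η • x k + √η • g` with standard Gaussian `g`. -/
noncomputable def postWeight (x : κ → E) (w : κ → ℝ) (η : ℝ) (y : E) (k : κ) : ℝ :=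
  w k * Real.exp (inner ℝ y (x k) - η * ‖x k‖ ^ 2 / 2)

/-- The joint law of signal and observation factors through the observation: the mean squared error
of the posterior barycentre is the expected posterior spread. -/
theorem sum_lintegral_sub_bary_postWeight (F : Finset κ) (hw : ∀ k, 0 < w k) (hη : 0 < η) :
    ∑ k ∈ F, ENNReal.ofReal (w k) *
        ∫⁻ g, ‖x k - bary F x (postWeight x w η (η • x k + √η • g))‖ₑ ^ 2 ∂stdGaussian E
      = ∫⁻ g, ENNReal.ofReal (spread F x (fun k => w k * lik √η (x k) g)) ∂stdGaussian E := by
  have hb := measurable_bary (F := F) (x := x)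
  have hpw : ∀ g, postWeight x w η (√η • g) = fun k => w k * lik √η (x k) g := by
    intro g
    ext k
    rw [postWeight, lik, real_inner_smul_left, Real.sq_sqrt hη.le]
  have hm : ∀ k, Measurable (fun g : E => ‖x k - bary F x (fun k => w k * lik √η (x k) g)‖ₑ ^ 2) :=
    fun k => by fun_prop
  have h1 : ∀ g, ENNReal.ofReal (spread F x (fun k => w k * lik √η (x k) g))
      = ∑ k ∈ F, ENNReal.ofReal (w k) * (ENNReal.ofReal (lik √η (x k) g) *
        ‖x k - bary F x (fun k => w k * lik √η (x k) g)‖ₑ ^ 2) := by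
    intro g
    rw [spread, ENNReal.ofReal_sum_of_nonneg fun k _ =>
      mul_nonneg (mul_pos (hw k) (lik_pos _ _ _)).le (sq_nonneg _)]
    refine Finset.sum_congr rfl fun k _ => ?_
    rw [ENNReal.ofReal_mul (mul_pos (hw k) (lik_pos _ _ _)).le, ENNReal.ofReal_mul (hw k).le,
      mul_assoc, ENNReal.ofReal_pow (norm_nonneg _), ofReal_norm]
  simp_rw [h1]
  rw [lintegral_finsetSum _ fun k _ => by fun_prop]
  refine Finset.sum_congr rfl fun k _ => ?_
  rw [lintegral_const_mul _ (by fun_prop), lintegral_lik_mul _ _ (hm k)]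
  congr 1
  refine lintegral_congr fun g => ?_
  have e : η • x k + √η • g = √η • (g + √η • x k) := by
    rw [smul_add, smul_smul, Real.mul_self_sqrt hη.le, add_comm]
  rw [e, hpw]

theorem massEntropy_le_sum_negMulLog {F : Finset κ} (hw : ∀ k, 0 < w k) (hF : F.Nonempty)
    (hF1 : ∑ k ∈ F, w k ≤ 1) : massEntropy F w ≤ ∑ k ∈ F, Real.negMulLog (w k) := by
  refine Finset.sum_le_sum fun k hk => ?_
  have hQ : 0 < ∑ k ∈ F, w k := Finset.sum_pos (fun k _ => hw k) hF
  rw [Real.log_div hQ.ne' (hw k).ne', Real.negMulLog]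
  have := mul_nonpos_of_nonneg_of_nonpos (hw k).le (Real.log_nonpos hQ.le hF1)
  linarith

variable [Countable κ]

/-- For a countable mixture there is an estimator, the posterior mean, whose mean squared error at
signal-to-noise ratio `η` is at most `2 / η` times the entropy of the weights. -/
theorem exists_estimator [Nonempty κ] (hw : ∀ k, 0 < w k) (hws : Summable w) (hw1 : ∑' k, w k ≤ 1)
    (hwx : Summable fun k => w k * ‖x k‖) (hη : 0 < η) :
    ∃ h : E → E, Measurable h ∧
      ENNReal.ofReal η * ∑' k, ENNReal.ofReal (w k) *
          ∫⁻ g, ‖x k - h (η • x k + √η • g)‖ₑ ^ 2 ∂stdGaussian E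
        ≤ 2 * ∑' k, ENNReal.ofReal (Real.negMulLog (w k)) := by
  classical
  -- The exponential in `postWeight` is bounded in `k`, by completing the square.
  have hexp : ∀ y k, Real.exp (inner ℝ y (x k) - η * ‖x k‖ ^ 2 / 2)
      ≤ Real.exp (‖y‖ ^ 2 / (2 * η)) := by
    intro y k
    refine Real.exp_le_exp.2 ?_
    have h1 := real_inner_le_norm y (x k)
    have h2 : ‖y‖ ^ 2 / (2 * η) - (‖y‖ * ‖x k‖ - η * ‖x k‖ ^ 2 / 2)
        = (‖y‖ - η * ‖x k‖) ^ 2 / (2 * η) := by field_simp; ring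
    have h3 : 0 ≤ (‖y‖ - η * ‖x k‖) ^ 2 / (2 * η) := by positivity
    linarith
  have hpos : ∀ y k, 0 < postWeight x w η y k := fun y k => mul_pos (hw k) (Real.exp_pos _)
  have hs1 : ∀ y, Summable (postWeight x w η y) := fun y =>
    Summable.of_nonneg_of_le (fun k => (hpos y k).le)
      (fun k => mul_le_mul_of_nonneg_left (hexp y k) (hw k).le) (hws.mul_right _)
  have hs2 : ∀ y, Summable fun k => postWeight x w η y k • x k := fun y => by
    refine Summable.of_norm_bounded (hwx.mul_right (Real.exp (‖y‖ ^ 2 / (2 * η)))) fun k => ?_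
    rw [norm_smul, Real.norm_of_nonneg (hpos y k).le, postWeight, mul_right_comm]
    exact mul_le_mul_of_nonneg_left (hexp y k) (mul_nonneg (hw k).le (norm_nonneg _))
  let h : E → E := fun y =>
    (∑' k, postWeight x w η y k)⁻¹ • ∑' k, postWeight x w η y k • x k
  have hlim : ∀ y, Filter.Tendsto (fun F : Finset κ => bary F x (postWeight x w η y)) Filter.atTop
      (nhds (h y)) := fun y =>
    ((hs1 y).hasSum.inv₀ ((hs1 y).tsum_pos (fun k => (hpos y k).le) (Classical.arbitrary κ)
      (hpos y _)).ne').smul (hs2 y).hasSum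
  have hbm : ∀ F : Finset κ, Measurable (fun y => bary F x (postWeight x w η y)) := fun F =>
    measurable_bary.comp (measurable_pi_lambda _ fun k => by unfold postWeight; fun_prop)
  refine ⟨h, measurable_of_tendsto_metrizable' Filter.atTop hbm (tendsto_pi_nhds.2 hlim), ?_⟩
  have hfin : ∀ F : Finset κ, F.Nonempty → ENNReal.ofReal η * ∑ k ∈ F, ENNReal.ofReal (w k) *
        ∫⁻ g, ‖x k - bary F x (postWeight x w η (η • x k + √η • g))‖ₑ ^ 2 ∂stdGaussian E
      ≤ 2 * ∑' k, ENNReal.ofReal (Real.negMulLog (w k)) := by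
    intro F hF
    rw [sum_lintegral_sub_bary_postWeight F hw hη]
    refine (mul_lintegral_spread_le hF (fun k _ => hw k) hη).trans ?_
    gcongr
    have hle1 : ∑ k ∈ F, w k ≤ 1 := (hws.sum_le_tsum F fun k _ => (hw k).le).trans hw1
    refine (ENNReal.ofReal_le_ofReal (massEntropy_le_sum_negMulLog hw hF hle1)).trans ?_
    rw [ENNReal.ofReal_sum_of_nonneg fun k hk => Real.negMulLog_nonneg (hw k).le
      ((Finset.single_le_sum (fun i _ => (hw i).le) hk).trans hle1)]
    exact ENNReal.sum_le_tsum F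
  rw [← ENNReal.tsum_mul_left]
  refine ENNReal.summable.tsum_le_of_sum_le fun F₀ => ?_
  rw [← Finset.mul_sum]
  have hm : ∀ (k : κ) (F : Finset κ),
      Measurable fun g : E => ENNReal.ofReal (w k) *
        ‖x k - bary F x (postWeight x w η (η • x k + √η • g))‖ₑ ^ 2 := fun k F => by
    have := (hbm F).comp (show Measurable fun g : E => η • x k + √η • g by fun_prop)
    exact ((this.const_sub _).enorm.pow_const 2).const_mul _
  have hmh : Measurable h := measurable_of_tendsto_metrizable' Filter.atTop hbm
    (tendsto_pi_nhds.2 hlim)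
  have hfatou : ∑ k ∈ F₀, ENNReal.ofReal (w k) *
        ∫⁻ g, ‖x k - h (η • x k + √η • g)‖ₑ ^ 2 ∂stdGaussian E
      ≤ Filter.liminf (fun F : Finset κ => ∫⁻ g, ∑ k ∈ F₀, ENNReal.ofReal (w k) *
        ‖x k - bary F x (postWeight x w η (η • x k + √η • g))‖ₑ ^ 2 ∂stdGaussian E)
        Filter.atTop := by
    refine le_trans (le_of_eq ?_) (lintegral_liminf_le fun F =>
      Finset.measurable_sum _ fun k _ => hm k F)
    simp_rw [← lintegral_const_mul' _ _ ENNReal.ofReal_ne_top]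
    rw [← lintegral_finsetSum _ fun k _ => by fun_prop]
    refine lintegral_congr fun g => (Filter.Tendsto.liminf_eq ?_).symm
    refine tendsto_finsetSum _ fun k _ => ENNReal.Tendsto.const_mul ?_
      (Or.inr ENNReal.ofReal_ne_top)
    exact ((ENNReal.continuous_pow 2).tendsto _).comp
      ((continuous_enorm.tendsto _).comp ((hlim _).const_sub (x k)))
  have hη0 : ENNReal.ofReal η ≠ 0 := by simpa using hη
  rw [mul_comm, ← ENNReal.le_div_iff_mul_le (Or.inl hη0) (Or.inl ENNReal.ofReal_ne_top)]
  refine hfatou.trans (Filter.liminf_le_of_frequently_le' (Filter.Eventually.frequently ?_))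
  filter_upwards [Filter.eventually_ge_atTop (insert (Classical.arbitrary κ) F₀)] with F hF
  rw [ENNReal.le_div_iff_mul_le (Or.inl hη0) (Or.inl ENNReal.ofReal_ne_top), mul_comm]
  refine le_trans ?_ (hfin F ⟨_, hF (Finset.mem_insert_self _ _)⟩)
  gcongr
  rw [lintegral_finsetSum _ fun k _ => hm k F]
  simp_rw [lintegral_const_mul' _ _ ENNReal.ofReal_ne_top]
  exact Finset.sum_le_sum_of_subset ((Finset.subset_insert _ _).trans hF)

end CountableMixture

/-! ### Entropy of the signal and mean-square estimation -/

section Entropy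

/-- Relabelling the values of a discrete random variable does not increase its entropy. -/
theorem shannonEntropy_map_le {ι α : Type*} (π : PMF ι) (f : ι → α) :
    shannonEntropy (π.map f) ≤ shannonEntropy π := by
  classical
  rw [shannonEntropy, shannonEntropy, ← ENNReal.tsum_fiberwise _ f]
  refine ENNReal.tsum_le_tsum fun u => ?_
  have hp : π.map f u = ∑' j : f ⁻¹' {u}, π j := by
    rw [PMF.map_apply, tsum_subtype (f ⁻¹' {u}) π]
    refine tsum_congr fun j => ?_
    simp [Set.indicator, eq_comm]
  have hfin : π.map f u ≠ ∞ := PMF.apply_ne_top _ _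
  set L : ℝ := -Real.log (π.map f u).toReal with hL
  have hmul : ENNReal.ofReal (Real.negMulLog (π.map f u).toReal)
      = π.map f u * ENNReal.ofReal L := by
    rw [Real.negMulLog, neg_mul_comm, ENNReal.ofReal_mul ENNReal.toReal_nonneg,
      ENNReal.ofReal_toReal hfin]
  rw [hmul, hp, ← ENNReal.tsum_mul_right]
  refine ENNReal.tsum_le_tsum fun j => ?_
  rw [Real.negMulLog, neg_mul_comm, ENNReal.ofReal_mul ENNReal.toReal_nonneg,
    ENNReal.ofReal_toReal (PMF.apply_ne_top _ _)]
  rcases eq_or_ne (π j) 0 with h0 | h0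
  · simp [h0]
  have hle : π j ≤ π.map f u := by
    rw [hp]
    exact ENNReal.le_tsum j
  gcongr
  exact neg_le_neg (Real.log_le_log (ENNReal.toReal_pos h0 (PMF.apply_ne_top _ _))
    (ENNReal.toReal_mono hfin hle))

theorem PMF.lintegral_eq_tsum_support {α : Type*} [MeasurableSpace α] [MeasurableSingletonClass α]
    (p : PMF α) (f : α → ℝ≥0∞) : ∫⁻ a, f a ∂p.toMeasure = ∑' a : p.support, p a * f a := by
  rw [← p.restrict_toMeasure_support, lintegral_countable _ p.support_countable]
  refine tsum_congr fun a => ?_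
  rw [p.toMeasure_apply_singleton _ (measurableSet_singleton _),
    mul_comm]

end Entropy

section MeanSquare

theorem eLpNorm_two_sq {Ω E : Type*} [MeasurableSpace Ω] {P : Measure Ω} [NormedAddCommGroup E]
    (f : Ω → E) : eLpNorm f 2 P ^ 2 = ∫⁻ ω, ‖f ω‖ₑ ^ 2 ∂P := by
  have h := eLpNorm_nnreal_pow_eq_lintegral (f := f) (μ := P) (p := 2) (by norm_num)
  simpa using h

/-- The conditional expectation is the best mean-square approximation. -/
theorem lintegral_sub_condExp_le {Ω E : Type*} {m m0 : MeasurableSpace Ω} {P : Measure Ω}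
    [IsFiniteMeasure P] [NormedAddCommGroup E] [InnerProductSpace ℝ E] [CompleteSpace E]
    (hm : m ≤ m0) {U Z : Ω → E} (hU : MemLp U 2 P) (hZ : StronglyMeasurable[m] Z) :
    ∫⁻ ω, ‖U ω - (P[U | m]) ω‖ₑ ^ 2 ∂P ≤ ∫⁻ ω, ‖U ω - Z ω‖ₑ ^ 2 ∂P := by
  have : Fact (m ≤ m0) := ⟨hm⟩
  have hZ0 : AEStronglyMeasurable Z P := (hZ.mono hm).aestronglyMeasurable
  rcases eq_or_ne (∫⁻ ω, ‖U ω - Z ω‖ₑ ^ 2 ∂P) ∞ with h | h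
  · simp [h]
  have hUZ : MemLp (fun ω => U ω - Z ω) 2 P := by
    refine ⟨hU.1.sub hZ0, lt_top_iff_ne_top.2 fun htop => h ?_⟩
    rw [← eLpNorm_two_sq (P := P) (fun ω => U ω - Z ω), htop]
    simp
  have hZL : MemLp Z 2 P := by
    have := hU.sub hUZ
    refine this.ae_eq (Filter.Eventually.of_forall fun ω => ?_)
    simp
  have hz : hZL.toLp ∈ lpMeas E ℝ m 2 P := mem_lpMeas_iff_aestronglyMeasurable.2
    (hZ.aestronglyMeasurable.congr hZL.coeFn_toLp.symm)
  have hle : ‖hU.toLp - (condExpL2 E ℝ hm hU.toLp : Lp E 2 P)‖ ≤ ‖hU.toLp - hZL.toLp‖ := by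
    have h1 := Submodule.starProjection_minimal (U := lpMeas E ℝ m 2 P) hU.toLp
    rw [Submodule.starProjection_apply] at h1
    exact h1.trans_le (ciInf_le ⟨0, by rintro _ ⟨y, rfl⟩; exact norm_nonneg _⟩
      (⟨hZL.toLp, hz⟩ : lpMeas E ℝ m 2 P))
  have e1 : eLpNorm (fun ω => U ω - (P[U | m]) ω) 2 P
      = ‖hU.toLp - (condExpL2 E ℝ hm hU.toLp : Lp E 2 P)‖ₑ := by
    rw [Lp.enorm_def]
    refine eLpNorm_congr_ae ?_
    filter_upwards [Lp.coeFn_sub hU.toLp (condExpL2 E ℝ hm hU.toLp : Lp E 2 P), hU.coeFn_toLp,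
      hU.condExpL2_ae_eq_condExp (𝕜 := ℝ) hm] with ω h1 h2 h3
    rw [h1, Pi.sub_apply, h2, h3]
  have e2 : eLpNorm (fun ω => U ω - Z ω) 2 P = ‖hU.toLp - hZL.toLp‖ₑ := by
    rw [Lp.enorm_def]
    refine eLpNorm_congr_ae ?_
    filter_upwards [Lp.coeFn_sub hU.toLp hZL.toLp, hU.coeFn_toLp, hZL.coeFn_toLp] with ω h1 h2 h3
    rw [h1, Pi.sub_apply, h2, h3]
  rw [← eLpNorm_two_sq (P := P) (fun ω => U ω - (P[U | m]) ω),
    ← eLpNorm_two_sq (P := P) (fun ω => U ω - Z ω), e1, e2]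
  gcongr
  exact enorm_le_iff_norm_le.2 hle

variable {E : Type*} [NormedAddCommGroup E] [InnerProductSpace ℝ E] [FiniteDimensional ℝ E]
  [MeasurableSpace E] [BorelSpace E]

/-- Adding centred Gaussian noise does not decrease the second moment. -/
theorem enorm_sq_le_lintegral_add_smul (u : E) (ε : ℝ) :
    ‖u‖ₑ ^ 2 ≤ ∫⁻ g, ‖u + ε • g‖ₑ ^ 2 ∂stdGaussian E := by
  have hsymm : ∫⁻ g, ‖u - ε • g‖ₑ ^ 2 ∂stdGaussian E = ∫⁻ g, ‖u + ε • g‖ₑ ^ 2 ∂stdGaussian E := by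
    conv_rhs => rw [← stdGaussian_map (LinearIsometryEquiv.neg ℝ (E := E))]
    rw [lintegral_map (by fun_prop) (by fun_prop)]
    simp [sub_eq_add_neg]
  have hpt : ∀ g : E, 2 * ‖u‖ₑ ^ 2 ≤ ‖u + ε • g‖ₑ ^ 2 + ‖u - ε • g‖ₑ ^ 2 := by
    intro g
    have h := parallelogram_law_with_norm ℝ u (ε • g)
    simp only [← ofReal_norm, ← ENNReal.ofReal_pow (norm_nonneg _)]
    rw [← ENNReal.ofReal_add (by positivity) (by positivity),
      show (2 : ℝ≥0∞) = ENNReal.ofReal 2 by simp, ← ENNReal.ofReal_mul (by norm_num)]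
    exact ENNReal.ofReal_le_ofReal (by nlinarith [sq_nonneg ‖ε • g‖])
  have h2 : 2 * ‖u‖ₑ ^ 2 ≤ 2 * ∫⁻ g, ‖u + ε • g‖ₑ ^ 2 ∂stdGaussian E := by
    calc 2 * ‖u‖ₑ ^ 2 = ∫⁻ _, 2 * ‖u‖ₑ ^ 2 ∂stdGaussian E := by simp
      _ ≤ ∫⁻ g, (‖u + ε • g‖ₑ ^ 2 + ‖u - ε • g‖ₑ ^ 2) ∂stdGaussian E := lintegral_mono hpt
      _ = _ := by rw [lintegral_add_left (by fun_prop), hsymm, two_mul]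
  exact (ENNReal.mul_le_mul_iff_right (by norm_num) (by norm_num)).1 h2

theorem lintegral_of_indepFun {Ω α : Type*} [MeasurableSpace Ω] {P : Measure Ω}
    [IsProbabilityMeasure P] [MeasurableSpace α] {X : Ω → α} {G : Ω → E} (hX : Measurable X)
    (hG : Measurable G) (hlaw : P.map G = stdGaussian E) (hi : IndepFun X G P)
    {f : α × E → ℝ≥0∞} (hf : Measurable f) :
    ∫⁻ ω, f (X ω, G ω) ∂P = ∫⁻ a, ∫⁻ g, f (a, g) ∂stdGaussian E ∂P.map X := by
  have h := (indepFun_iff_map_prod_eq_prod_map_map hX.aemeasurable hG.aemeasurable).1 hi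
  have : IsProbabilityMeasure (P.map X) := Measure.isProbabilityMeasure_map hX.aemeasurable
  rw [← lintegral_map hf (hX.prodMk hG), h, hlaw, lintegral_prod _ hf.aemeasurable]

end MeanSquare

/-! ### The minimum mean squared error -/

section Mmse

variable {Ω : Type*} [MeasurableSpace Ω] {P : Measure Ω} [IsProbabilityMeasure P] {d : ℕ}
  {U G : Ω → EuclideanSpace ℝ (Fin d)} {η : ℝ}

/-- Any measurable function of the observation bounds the minimum mean squared error. -/
theorem mmse_le (hU : MemLp U 2 P) (hUm : Measurable U) (hGm : Measurable G)
    {h : EuclideanSpace ℝ (Fin d) → EuclideanSpace ℝ (Fin d)} (hh : Measurable h) :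
    mmse P U G η ≤ ∫⁻ ω, ‖U ω - h (U ω + η ^ (-(1 / 2) : ℝ) • G ω)‖ₑ ^ 2 ∂P := by
  have hY : Measurable (fun ω => U ω + η ^ (-(1 / 2) : ℝ) • G ω) := by fun_prop
  exact lintegral_sub_condExp_le hY.comap_le hU
    (hh.comp (comap_measurable (fun ω => U ω + η ^ (-(1 / 2) : ℝ) • G ω))).stronglyMeasurable

/-- The entropy bound in terms of the law `p` of the signal, whose atoms index the mixture. -/
theorem mmse_le_shannonEntropy (p : PMF (EuclideanSpace ℝ (Fin d))) (hU : MemLp U 2 P)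
    (hUm : Measurable U) (hp : P.map U = p.toMeasure) (hGm : Measurable G)
    (hG : P.map G = stdGaussian (EuclideanSpace ℝ (Fin d))) (hUG : IndepFun U G P) (hη : 0 < η) :
    mmse P U G η ≤ 2 * shannonEntropy p / ENNReal.ofReal η := by
  let κ := p.support
  have : Countable κ := p.support_countable.to_subtype
  have : Nonempty κ := p.support_nonempty.to_subtype
  let x : κ → EuclideanSpace ℝ (Fin d) := Subtype.val
  let w : κ → ℝ := fun k => (p k).toReal
  have hofReal : ∀ k, ENNReal.ofReal (w k) = p k := fun k =>
    ENNReal.ofReal_toReal (p.apply_ne_top _)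
  have hw : ∀ k, 0 < w k := fun k =>
    ENNReal.toReal_pos ((p.mem_support_iff _).1 k.2) (p.apply_ne_top _)
  have htsum : ∑' k : κ, p k = 1 := by
    rw [← p.tsum_coe]
    exact tsum_subtype_eq_of_support_subset (fun a ha => ha)
  have hws : Summable w := ENNReal.summable_toReal (by rw [htsum]; simp)
  have hw1 : ∑' k, w k ≤ 1 := by
    rw [← ENNReal.tsum_toReal_eq fun k => p.apply_ne_top _, htsum]
    simp
  have hmom : ∑' k : κ, p k * ‖x k‖ₑ ^ 2 ≠ ∞ := by
    rw [← PMF.lintegral_eq_tsum_support p (fun u => ‖u‖ₑ ^ 2), ← hp,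
      lintegral_map (by fun_prop) hUm, ← eLpNorm_two_sq U]
    exact ENNReal.pow_ne_top hU.2.ne
  have hwx2 : Summable fun k => w k * ‖x k‖ ^ 2 := by
    simpa [w, ENNReal.toReal_mul] using ENNReal.summable_toReal hmom
  have hwx : Summable fun k => w k * ‖x k‖ := by
    refine Summable.of_nonneg_of_le (fun k => mul_nonneg (hw k).le (norm_nonneg _)) (fun k => ?_)
      (hws.add hwx2)
    nlinarith [hw k, mul_nonneg (hw k).le (sq_nonneg (‖x k‖ - 1)),
      mul_nonneg (hw k).le (norm_nonneg (x k))]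
  obtain ⟨h, hhm, hh⟩ := exists_estimator hw hws hw1 hwx hη
  have hη0 : ENNReal.ofReal η ≠ 0 := by simpa using hη
  have hent : ∑' k, ENNReal.ofReal (Real.negMulLog (w k)) ≤ shannonEntropy p :=
    ENNReal.tsum_comp_le_tsum_of_injective Subtype.val_injective
      (fun u => ENNReal.ofReal (Real.negMulLog (p u).toReal))
  -- Multiplying the observation by `η` turns the noise level `η^{-1/2}` into `√η`.
  have hscale : η * η ^ (-(1 / 2) : ℝ) = √η := by
    nth_rewrite 1 [← Real.rpow_one η]
    rw [← Real.rpow_add hη, Real.sqrt_eq_rpow]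
    norm_num
  have hhη : Measurable fun y => h (η • y) := by fun_prop
  have key : ∫⁻ ω, ‖U ω - h (η • (U ω + η ^ (-(1 / 2) : ℝ) • G ω))‖ₑ ^ 2 ∂P
      = ∑' k, ENNReal.ofReal (w k) * ∫⁻ g, ‖x k - h (η • x k + √η • g)‖ₑ ^ 2
        ∂stdGaussian (EuclideanSpace ℝ (Fin d)) := by
    rw [lintegral_of_indepFun hUm hGm hG hUG
      (f := fun z => ‖z.1 - h (η • (z.1 + η ^ (-(1 / 2) : ℝ) • z.2))‖ₑ ^ 2) (by fun_prop), hp,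
      PMF.lintegral_eq_tsum_support]
    refine tsum_congr fun k => ?_
    rw [hofReal]
    simp only [smul_add, smul_smul, hscale, x]
  refine (mmse_le hU hUm hGm hhη).trans ?_
  rw [key, ENNReal.le_div_iff_mul_le (Or.inl hη0) (Or.inl ENNReal.ofReal_ne_top), mul_comm]
  exact hh.trans (by gcongr)

end Mmse

theorem mainTheorem2 {Ω : Type*} [MeasurableSpace Ω] (P : Measure Ω) [IsProbabilityMeasure P]
    {ι : Type*} [MeasurableSpace ι] [DiscreteMeasurableSpace ι] {d : ℕ}
    (π : PMF ι) (μ : ι → EuclideanSpace ℝ (Fin d)) (ε : ℝ) (J : Ω → ι)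
    (G₀ : Ω → EuclideanSpace ℝ (Fin d)) (R : ℝ≥0)
    (hZ : IsGaussianMixtureTarget P π μ ε J G₀ R)
    (G : Ω → EuclideanSpace ℝ (Fin d)) (hGm : Measurable G)
    (hG : P.map G = stdGaussian (EuclideanSpace ℝ (Fin d)))
    (hUG : IndepFun (fun ω => μ (J ω)) G P)
    (η : ℝ) (hη : 0 < η) :
    mmse P (fun ω => μ (J ω)) G η
      ≤ min (R : ℝ≥0∞) (2 * shannonEntropy π / ENNReal.ofReal η) := by
  have hμ : Measurable μ := Measurable.of_discrete
  have hUm : Measurable fun ω => μ (J ω) := hμ.comp hZ.measurable_latent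
  have hsecond : ∫⁻ ω, ‖μ (J ω)‖ₑ ^ 2 ∂P ≤ R := by
    rw [← hZ.second_moment, lintegral_of_indepFun hZ.measurable_latent hZ.measurable_noise
      hZ.law_noise hZ.indep (f := fun z => ‖μ z.1 + ε • z.2‖ₑ ^ 2) (by fun_prop),
      ← lintegral_map (f := fun j => ‖μ j‖ₑ ^ 2) (by fun_prop) hZ.measurable_latent]
    exact lintegral_mono fun j => enorm_sq_le_lintegral_add_smul (μ j) ε
  have hU : MemLp (fun ω => μ (J ω)) 2 P := by
    refine ⟨hUm.aestronglyMeasurable, lt_top_iff_ne_top.2 fun htop => ?_⟩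
    rw [← eLpNorm_two_sq (P := P) (fun ω => μ (J ω)), htop] at hsecond
    simp at hsecond
  refine le_min ?_ ?_
  · refine le_trans ?_ hsecond
    simpa using mmse_le (η := η) hU hUm hGm (h := fun _ => 0) measurable_const
  · have hlaw : P.map (fun ω => μ (J ω)) = (π.map μ).toMeasure := by
      rw [← PMF.toMeasure_map _ _ hμ, ← hZ.law_latent,
        Measure.map_map hμ hZ.measurable_latent]
      rfl
    refine (mmse_le_shannonEntropy (π.map μ) hU hUm hlaw hGm hG hUG hη).trans ?_
    gcongr
    exact shannonEntropy_map_le π μ
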